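/- Let $\phi=\frac{1+\sqrt5}{2}$. For an integer $b\ge 2$, a base $b$ over-expansion of a positive integer $N$ is a word $d_kd_{k-1}\cdots d_0$ over the alphabet $\{0,1,\ldots,b\}$ such that $d_k\ne 0$ and $\sum_{i=0}^k d_ib^i=N$. Let $s_b(0)=0$, $s_b(1)=1$, and for $n\ge 2$ let $s_b(n)$ be the number of base $b$ over-expansions of $n-1$. Then, for every integer $b\ge 2$, \[\limsup_{n\to\infty}\frac{s_b(n)}{n^{\log_b\phi}}=\frac{(b^2-1)^{\log_b\phi}}{\sqrt5}.\] In particular, if $(s(n))_{n\ge0}$ is Stern's diatomic sequence, defined by $s(0)=0$, $s(1)=1$, $s(2n)=s(n)$ and $s(2n+1)=s(n)+s(n+1)$, then \[\limsup_{n\to\infty}\frac{s(n)}{n^{\log_2\phi}}=\frac{3^{\log_2\phi}}{\sqrt5}.\] -/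

import Mathlib

open Filter

/-- The set of base `b` over-expansions of `N`: words `d_k ⋯ d_1 d_0` over the alphabet
`{0, 1, …, b}` with leading letter `d_k ≠ 0` and `∑ i, d_i * b ^ i = N`. A word is stored as the
nonempty list `[d_0, d_1, …, d_k]`, least significant digit first, so that its last entry is the
leading letter. -/
def overExpansions (b N : ℕ) : Set (List ℕ) :=
  {d | (∀ x ∈ d, x ≤ b) ∧ (∃ h : d ≠ [], d.getLast h ≠ 0) ∧ Nat.ofDigits b d = N}

theorem length_le_ofDigits {b : ℕ} (hb : 2 ≤ b) (d : List ℕ) (h : d ≠ [])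
    (h0 : d.getLast h ≠ 0) : d.length ≤ Nat.ofDigits b d := by
  induction d with
  | nil => exact absurd rfl h
  | cons a t ih =>
    rw [Nat.ofDigits_cons, List.length_cons]
    by_cases ht : t = []
    · subst ht
      simp at h0 ⊢
      omega
    · have h1 := ih ht (by rwa [List.getLast_cons ht] at h0)
      have h2 : 0 < t.length := List.length_pos_iff.mpr ht
      nlinarith

/-- The set of over-expansions is finite, so that counting it with `Set.ncard` is meaningful. -/
theorem overExpansions_finite {b : ℕ} (hb : 2 ≤ b) (N : ℕ) : (overExpansions b N).Finite := by
  have key : (overExpansions b N) ⊆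
      (fun l : List (Fin (b + 1)) => l.map Fin.val) '' {l | l.length ≤ N} := by
    rintro d ⟨hd, ⟨h, h0⟩, hN⟩
    refine ⟨d.pmap (fun x hx => (⟨x, hx⟩ : Fin (b + 1)))
      (fun x hx => Nat.lt_succ_of_le (hd x hx)), ?_, ?_⟩
    · have := length_le_ofDigits hb d h h0
      simp only [Set.mem_ofPred_eq, List.length_pmap]
      omega
    · simp [List.map_pmap]
  exact ((List.finite_length_le (Fin (b + 1)) N).image _).subset key

/-- `sternB b n = s_b(n)`: the number of base `b` over-expansions of `n - 1` for `n ≥ 2`, with the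
conventions `s_b(0) = 0` and `s_b(1) = 1`. -/
noncomputable def sternB (b : ℕ) : ℕ → ℕ
  | 0 => 0
  | 1 => 1
  | n + 2 => (overExpansions b (n + 1)).ncard

/-- Stern's diatomic sequence: `s(0) = 0`, `s(1) = 1`, `s(2n) = s(n)`,
`s(2n+1) = s(n) + s(n+1)`. -/
def stern : ℕ → ℕ
  | 0 => 0
  | 1 => 1
  | n + 2 =>
    if n % 2 = 0 then stern ((n + 2) / 2) else stern ((n + 2) / 2) + stern ((n + 2) / 2 + 1)
termination_by n => n
decreasing_by all_goals omega

theorem stern_two_mul (n : ℕ) : stern (2 * n) = stern n := by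
  rcases n with _ | n
  · rfl
  · rw [show 2 * (n + 1) = 2 * n + 2 by ring, stern, if_pos (by omega)]
    congr 1
    omega

theorem stern_two_mul_add_one (n : ℕ) : stern (2 * n + 1) = stern n + stern (n + 1) := by
  rcases n with _ | n
  · simp [stern]
  · rw [show 2 * (n + 1) + 1 = (2 * n + 1) + 2 by ring, stern, if_neg (by omega)]
    congr 2 <;> omega

/-!
Both `sternB b` and Stern's sequence satisfy the recurrences `s (b n + 1) = s n + s (n + 1)` and
`s (b n + i) = s (n + 1)` for `2 ≤ i ≤ b` (`IsSternSeq`): the last digit of an over-expansion is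
determined by its residue modulo `b`, except for the choice between `0` and `b`. Everything else
uses these recurrences only.

*Upper bound.* Let `node b j = (b ^ (j + 1) - 1) / (b ^ 2 - 1)`, a real number, and let `chord b j`
be the affine function with values `fib (j + 1)` at `node b j` and `fib (j + 2)` at
`node b (j + 1)`. The chords bound a concave region, and they satisfy
`chord (j + 2) (b² x + 1) = chord (j + 1) (b x + 1 - θ) + chord j x` with `θ = b / (b + 1)`
(`chord_add_two`), the relation that the largest values of `s` satisfy. By strong induction,
`s (b n + 1) ≤ chord j (b n + 1)` for every `j ≥ 1`, and even `s (b n + 1) ≤ chord j (b n + 1 - θ)`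
when `b ∤ n` (`IsSternSeq.chordBound`). The shift by `θ` is what makes the induction close. For
`n = b k` with `b ∤ k`, the sum `s (b k + 1) + s k` is matched with the identity at `x = k`, which
requires the shifted bound at `b k + 1`; for `n = b k + 1`, the sum `s (b k + 1) + s (k + 1)` is
matched with it at `x = k + 1 - θ`. Where the shifted bound is needed but not available, two
adjacent digits are `0` and the resulting slack exceeds the shift. Hence
`s n ≤ chord j n` for all `n ≥ 1` (`IsSternSeq.le_chord`).

Up to a bounded error, `chord b j` at `x` is the chord of the concave function
`x ↦ ((b² - 1) x) ^ log_b φ / √5` over `b ^ (j + 1) ≤ (b² - 1) x ≤ b ^ (j + 2)`, by Binet's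
formula, so `s n ≤ ((b² - 1) n) ^ log_b φ / √5 + 3` (`IsSternSeq.le_rpow`).

*Lower bound.* At the integers `n = (b ^ (2 i + 2) - 1) / (b² - 1)`, with base `b` digits
`1, 0, 1, …, 0, 1`, the value is `fib (2 i + 2)` (`IsSternSeq.apply_peak`), which is asymptotic to
the upper bound.
-/

/-! ### The recurrences -/

/-- A base `b` Stern sequence: the initial values and recurrences that determine `s_b`. For `b = 2`
these are the defining relations of Stern's diatomic sequence. -/
structure IsSternSeq (b : ℕ) (s : ℕ → ℕ) : Prop where
  zero : s 0 = 0
  one : s 1 = 1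
  mul_add_one : ∀ n, s (b * n + 1) = s n + s (n + 1)
  mul_add : ∀ n i, 2 ≤ i → i ≤ b → s (b * n + i) = s (n + 1)

theorem isSternSeq_stern : IsSternSeq 2 stern where
  zero := by simp [stern]
  one := by simp [stern]
  mul_add_one := stern_two_mul_add_one
  mul_add n i h1 h2 := by
    obtain rfl : i = 2 := le_antisymm h2 h1
    rw [show 2 * n + 2 = 2 * (n + 1) by ring, stern_two_mul]

/-- Over-expansions of `N`, with the empty word admitted as the one over-expansion of `0`. For
`N ≠ 0` these are the over-expansions proper, and the digit recursion has no exceptional case. -/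
def reducedWords (b N : ℕ) : Set (List ℕ) :=
  {d | (∀ x ∈ d, x ≤ b) ∧ (∀ h : d ≠ [], d.getLast h ≠ 0) ∧ Nat.ofDigits b d = N}

theorem reducedWords_eq_overExpansions {b N : ℕ} (hN : N ≠ 0) :
    reducedWords b N = overExpansions b N := by
  ext d
  constructor
  · rintro ⟨h1, h2, h3⟩
    have hd : d ≠ [] := by
      rintro rfl
      exact hN (by simpa using h3.symm)
    exact ⟨h1, ⟨hd, h2 hd⟩, h3⟩
  · rintro ⟨h1, ⟨_, h2⟩, h3⟩
    exact ⟨h1, fun _ => h2, h3⟩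

theorem reducedWords_zero {b : ℕ} (hb : 2 ≤ b) : reducedWords b 0 = {[]} := by
  ext d
  constructor
  · rintro ⟨_, h2, h3⟩
    by_contra hd
    have h4 := length_le_ofDigits hb d hd (h2 hd)
    rw [h3] at h4
    exact hd (List.length_eq_zero_iff.mp (by omega))
  · rintro rfl
    exact ⟨by simp, by simp, by simp⟩

theorem reducedWords_finite {b : ℕ} (hb : 2 ≤ b) (N : ℕ) : (reducedWords b N).Finite := by
  rcases eq_or_ne N 0 with rfl | hN
  · rw [reducedWords_zero hb]
    exact Set.finite_singleton _
  · rw [reducedWords_eq_overExpansions hN]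
    exact overExpansions_finite hb N

theorem cons_mem_reducedWords {b N a : ℕ} {t : List ℕ} (hN : N ≠ 0) :
    a :: t ∈ reducedWords b N ↔ a ≤ b ∧ ∃ M, a + b * M = N ∧ t ∈ reducedWords b M := by
  constructor
  · rintro ⟨h1, h2, h3⟩
    refine ⟨h1 a (by simp), Nat.ofDigits b t, ?_, fun x hx => h1 x (by simp [hx]),
      fun ht => ?_, rfl⟩
    · simpa [Nat.ofDigits_cons] using h3
    · have := h2 (by simp)
      rwa [List.getLast_cons ht] at this
  · rintro ⟨ha, M, hM, h1, h2, h3⟩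
    refine ⟨?_, fun _ => ?_, ?_⟩
    · intro x hx
      rcases List.mem_cons.mp hx with rfl | hx
      · exact ha
      · exact h1 x hx
    · by_cases ht : t = []
      · subst ht
        simp only [Nat.ofDigits_nil] at h3
        subst h3
        simp only [List.getLast_singleton]
        rintro rfl
        exact hN (by simpa using hM.symm)
      · rw [List.getLast_cons ht]
        exact h2 ht
    · rw [Nat.ofDigits_cons, h3]
      simpa using hM

theorem nil_notMem_reducedWords {b N : ℕ} (hN : N ≠ 0) : [] ∉ reducedWords b N := by
  rintro ⟨_, _, h3⟩
  exact hN (by simpa using h3.symm)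

/-- The last digit is forced when the residue modulo `b` is nonzero. -/
theorem ncard_reducedWords_mul_add {b r : ℕ} (M : ℕ) (hr : 1 ≤ r) (hrb : r < b) :
    (reducedWords b (b * M + r)).ncard = (reducedWords b M).ncard := by
  have hN : b * M + r ≠ 0 := by omega
  have : reducedWords b (b * M + r) = (fun t => r :: t) '' reducedWords b M := by
    ext d
    rcases d with _ | ⟨a, t⟩
    · simp [nil_notMem_reducedWords hN]
    · rw [cons_mem_reducedWords hN]
      constructor
      · rintro ⟨ha, M', hM, ht⟩
        have h1 : M' = M := by
          rcases lt_trichotomy M' M with h | h | h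
          · nlinarith
          · exact h
          · nlinarith
        subst h1
        exact ⟨t, ht, by rw [show a = r by omega]⟩
      · rintro ⟨t', ht, h⟩
        obtain ⟨rfl, rfl⟩ := List.cons.inj h
        exact ⟨hrb.le, M, by ring, ht⟩
  rw [this, Set.ncard_image_of_injective _ (List.cons_injective)]

/-- A multiple of `b` may end in the digit `b` or in the digit `0`. -/
theorem ncard_reducedWords_mul {b : ℕ} (hb : 2 ≤ b) (M : ℕ) :
    (reducedWords b (b * (M + 1))).ncard =
      (reducedWords b M).ncard + (reducedWords b (M + 1)).ncard := by
  have hN : b * (M + 1) ≠ 0 := by positivity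
  have : reducedWords b (b * (M + 1)) =
      (fun t => b :: t) '' reducedWords b M ∪ (fun t => 0 :: t) '' reducedWords b (M + 1) := by
    ext d
    rcases d with _ | ⟨a, t⟩
    · simp [nil_notMem_reducedWords hN]
    · rw [cons_mem_reducedWords hN]
      constructor
      · rintro ⟨ha, M', hM, ht⟩
        have h1 : M' = M ∨ M' = M + 1 := by
          -- `0 ≤ a ≤ b` leaves only the two quotients `M` and `M + 1`.
          have h2 : M ≤ M' := by
            by_contra! h
            nlinarith
          have h3 : M' ≤ M + 1 := by
            by_contra! h
            nlinarith
          omega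
        rcases h1 with rfl | rfl
        · exact Or.inl ⟨t, ht, by rw [show a = b by linarith]⟩
        · exact Or.inr ⟨t, ht, by rw [show a = 0 by omega]⟩
      · rintro (⟨t', ht, h⟩ | ⟨t', ht, h⟩)
        · obtain ⟨rfl, rfl⟩ := List.cons.inj h
          exact ⟨le_rfl, M, by ring, ht⟩
        · obtain ⟨rfl, rfl⟩ := List.cons.inj h
          exact ⟨Nat.zero_le _, M + 1, by ring, ht⟩
  rw [this, Set.ncard_union_eq _ ((reducedWords_finite hb _).image _)
    ((reducedWords_finite hb _).image _), Set.ncard_image_of_injective _ (List.cons_injective),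
    Set.ncard_image_of_injective _ (List.cons_injective)]
  rw [Set.disjoint_left]
  rintro _ ⟨t, _, rfl⟩ ⟨t', _, h⟩
  have := (List.cons.inj h).1
  omega

theorem sternB_succ {b : ℕ} (hb : 2 ≤ b) (n : ℕ) :
    sternB b (n + 1) = (reducedWords b n).ncard := by
  rcases n with _ | n
  · simp [sternB, reducedWords_zero hb]
  · rw [reducedWords_eq_overExpansions (by omega)]
    rfl

theorem isSternSeq_sternB {b : ℕ} (hb : 2 ≤ b) : IsSternSeq b (sternB b) where
  zero := rfl
  one := rfl
  mul_add_one n := by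
    rcases n with _ | n
    · simp [sternB]
    · rw [sternB_succ hb, sternB_succ hb, sternB_succ hb, ncard_reducedWords_mul hb]
  mul_add n i h1 h2 := by
    obtain ⟨r, rfl⟩ : ∃ r, i = r + 1 := ⟨i - 1, by omega⟩
    rw [← add_assoc, sternB_succ hb, sternB_succ hb,
      ncard_reducedWords_mul_add n (by omega) (by omega)]

/-! ### The chords of the extremal polygon -/

/-- The abscissa `(b ^ (j + 1) - 1) / (b ^ 2 - 1)` at which the bound takes the value
`Nat.fib (j + 1)`. For odd `j` it is the integer with base `b` digits `1, 0, 1, …, 0, 1`. -/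
noncomputable def node (b : ℝ) (j : ℕ) : ℝ := (b ^ (j + 1) - 1) / (b ^ 2 - 1)

/-- The slope of the chord from `(node b j, fib (j + 1))` to `(node b (j + 1), fib (j + 2))`. -/
noncomputable def chordSlope (b : ℝ) (j : ℕ) : ℝ := Nat.fib j * (b + 1) / b ^ (j + 1)

/-- The affine function through `(node b j, fib (j + 1))` and `(node b (j + 1), fib (j + 2))`. -/
noncomputable def chord (b : ℝ) (j : ℕ) (x : ℝ) : ℝ :=
  Nat.fib (j + 1) + chordSlope b j * (x - node b j)

section chords

variable {b : ℝ}

theorem chordSlope_nonneg (hb : 2 ≤ b) (j : ℕ) : 0 ≤ chordSlope b j := by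
  unfold chordSlope; positivity

theorem chordSlope_succ_le (hb : 2 ≤ b) {j : ℕ} (hj : 1 ≤ j) :
    chordSlope b (j + 1) ≤ chordSlope b j := by
  obtain ⟨i, rfl⟩ : ∃ i, j = i + 1 := ⟨j - 1, by omega⟩
  have h : (Nat.fib (i + 2) : ℝ) ≤ b * Nat.fib (i + 1) := by
    have h1 : Nat.fib (i + 2) ≤ 2 * Nat.fib (i + 1) := by
      rw [Nat.fib_add_two]
      have := Nat.fib_le_fib_succ (n := i)
      omega
    have h2 : (Nat.fib (i + 2) : ℝ) ≤ 2 * Nat.fib (i + 1) := by exact_mod_cast h1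
    have h3 : (0 : ℝ) ≤ Nat.fib (i + 1) := by positivity
    nlinarith
  unfold chordSlope
  rw [div_le_div_iff₀ (by positivity) (by positivity), pow_succ b (i + 1 + 1)]
  have h4 : 0 ≤ (b + 1) * b ^ (i + 1 + 1) := by positivity
  nlinarith

theorem chordSlope_anti (hb : 2 ≤ b) {i j : ℕ} (hi : 1 ≤ i) (hij : i ≤ j) :
    chordSlope b j ≤ chordSlope b i := by
  induction j, hij using Nat.le_induction with
  | base => exact le_rfl
  | succ j hj ih => exact (chordSlope_succ_le hb (hi.trans hj)).trans ih

theorem node_mono (hb : 2 ≤ b) : Monotone (node b) := by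
  intro i j h
  unfold node
  have h1 : b ^ (i + 1) ≤ b ^ (j + 1) := pow_le_pow_right₀ (by linarith) (by omega)
  have h2 : 0 < b ^ 2 - 1 := by nlinarith
  gcongr

theorem chord_mono (hb : 2 ≤ b) (j : ℕ) : Monotone (chord b j) := by
  intro x y h
  unfold chord
  have := mul_le_mul_of_nonneg_left h (chordSlope_nonneg hb j)
  linarith

theorem chord_sub (j : ℕ) (x y : ℝ) : chord b j x - chord b j y = chordSlope b j * (x - y) := by
  unfold chord; ring

theorem chord_node (j : ℕ) : chord b j (node b j) = Nat.fib (j + 1) := by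
  unfold chord; ring

theorem chord_node_succ (hb : 2 ≤ b) (j : ℕ) : chord b j (node b (j + 1)) = Nat.fib (j + 2) := by
  have h2 : b ^ 2 - 1 ≠ 0 := by nlinarith
  have h3 : node b (j + 1) - node b j = b ^ (j + 1) / (b + 1) := by
    unfold node
    have : b + 1 ≠ 0 := by linarith
    field_simp
    ring
  unfold chord chordSlope
  rw [h3, Nat.fib_add_two]
  have h0 : b ≠ 0 := by linarith
  have : b + 1 ≠ 0 := by linarith
  push_cast
  field_simp
  ring

/-- Consecutive chords cross at their common node, and slopes decrease. -/
theorem chord_succ_sub_chord (hb : 2 ≤ b) (j : ℕ) (x : ℝ) :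
    chord b (j + 1) x - chord b j x =
      (chordSlope b j - chordSlope b (j + 1)) * (node b (j + 1) - x) := by
  have h1 := chord_sub (b := b) (j + 1) x (node b (j + 1))
  have h2 := chord_sub (b := b) j x (node b (j + 1))
  rw [chord_node] at h1
  rw [chord_node_succ hb] at h2
  linarith

theorem chord_succ_le (hb : 2 ≤ b) {j : ℕ} (hj : 1 ≤ j) {x : ℝ} (hx : node b (j + 1) ≤ x) :
    chord b (j + 1) x ≤ chord b j x := by
  have h1 := chord_succ_sub_chord hb j x
  have h2 := chordSlope_succ_le hb hj
  nlinarith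

theorem chord_le_succ (hb : 2 ≤ b) {j : ℕ} (hj : 1 ≤ j) {x : ℝ} (hx : x ≤ node b (j + 1)) :
    chord b j x ≤ chord b (j + 1) x := by
  have h1 := chord_succ_sub_chord hb j x
  have h2 := chordSlope_succ_le hb hj
  nlinarith

/-- To the left of `node b 2` the first chord is the lowest one. -/
theorem chord_one_le (hb : 2 ≤ b) {j : ℕ} (hj : 1 ≤ j) {x : ℝ} (hx : x ≤ node b 2) :
    chord b 1 x ≤ chord b j x := by
  induction j, hj using Nat.le_induction with
  | base => exact le_rfl
  | succ j hj ih =>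
    exact ih.trans (chord_le_succ hb hj (hx.trans (node_mono hb (by omega))))

/-- The chords satisfy the extremal recurrence exactly, with the offset `1 / (b + 1)`. -/
theorem chord_add_two (hb : 2 ≤ b) (j : ℕ) (x : ℝ) :
    chord b (j + 2) (b ^ 2 * x + 1) = chord b (j + 1) (b * x + 1 - b / (b + 1)) + chord b j x := by
  have h0 : b ≠ 0 := by linarith
  have h1 : b + 1 ≠ 0 := by linarith
  have h2 : b ^ 2 - 1 ≠ 0 := by nlinarith
  have n2 : node b (j + 2) = b ^ 2 * node b j + 1 := by
    unfold node; field_simp; ring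
  have n1 : node b (j + 1) = b * node b j + 1 - b / (b + 1) := by
    unfold node; field_simp; ring
  have hs : b ^ 2 * chordSlope b (j + 2) = b * chordSlope b (j + 1) + chordSlope b j := by
    unfold chordSlope; rw [Nat.fib_add_two]; push_cast; field_simp; ring
  have hf : (Nat.fib (j + 2 + 1) : ℝ) = Nat.fib (j + 1 + 1) + Nat.fib (j + 1) := by
    rw [show j + 2 + 1 = (j + 1) + 2 by ring, Nat.fib_add_two]; push_cast; ring
  unfold chord
  rw [n2, n1, hf]
  linear_combination (x - node b j) * hs

theorem node_one (hb : 2 ≤ b) : node b 1 = 1 := by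
  have h2 : b ^ 2 - 1 ≠ 0 := by nlinarith
  unfold node; field_simp

theorem node_two (hb : 2 ≤ b) : node b 2 = b + 1 - b / (b + 1) := by
  have h2 : b ^ 2 - 1 ≠ 0 := by nlinarith
  have h1 : b + 1 ≠ 0 := by linarith
  unfold node; field_simp; ring

theorem node_three (hb : 2 ≤ b) : node b 3 = b ^ 2 + 1 := by
  have h2 : b ^ 2 - 1 ≠ 0 := by nlinarith
  unfold node; field_simp; ring

theorem node_four_le (hb : 2 ≤ b) : node b 4 ≤ b ^ 4 + 1 := by
  have h2 : 0 < b ^ 2 - 1 := by nlinarith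
  unfold node
  rw [div_le_iff₀ h2]
  have h3 : 0 ≤ b ^ 4 * (b ^ 2 - b - 1) := by
    have : 0 ≤ b ^ 2 - b - 1 := by nlinarith
    positivity
  have h4 : (b ^ 4 + 1) * (b ^ 2 - 1) - (b ^ (4 + 1) - 1) = b ^ 4 * (b ^ 2 - b - 1) + b ^ 2 := by
    ring
  linarith

end chords

/-! ### The bound by chords -/

namespace IsSternSeq

variable {b : ℕ} {s : ℕ → ℕ}

theorem mul_self (h : IsSternSeq b s) (hb : 2 ≤ b) (n : ℕ) : s (b * n) = s n := by
  rcases n with _ | n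
  · simp
  · rw [Nat.mul_succ]
    exact h.mul_add n b hb le_rfl

/-- Values at all indices are controlled by values at indices congruent to `1`. -/
theorem le_chord_of_residue_one (h : IsSternSeq b s) (hb : 2 ≤ b) {j m : ℕ} (hm : 1 ≤ m)
    (H : ∀ n, b * n + 1 ≤ m → (s (b * n + 1) : ℝ) ≤ chord b j (b * n + 1)) :
    (s m : ℝ) ≤ chord b j m := by
  have hb' : (2 : ℝ) ≤ b := by exact_mod_cast hb
  obtain ⟨n, i, hi, rfl⟩ : ∃ n i, i < b ∧ m = b * n + (i + 1) :=
    ⟨(m - 1) / b, (m - 1) % b, Nat.mod_lt _ (by omega), by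
      have := Nat.div_add_mod (m - 1) b
      omega⟩
  have h1 : s (b * n + (i + 1)) ≤ s (b * n + 1) := by
    rcases i with _ | i
    · exact le_rfl
    · rw [h.mul_add n _ (by omega) (by omega), h.mul_add_one]
      omega
  calc (s (b * n + (i + 1)) : ℝ) ≤ s (b * n + 1) := by exact_mod_cast h1
    _ ≤ chord b j (b * n + 1) := H n (by omega)
    _ ≤ chord b j ((b * n + (i + 1) : ℕ) : ℝ) := by
      apply chord_mono hb'
      push_cast
      have : (0 : ℝ) ≤ i := by positivity
      linarith

/-- If `n` is not divisible by `b`, then `s (b * n + 1)` is bounded in terms of the quotient. -/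
theorem mul_add_one_le (h : IsSternSeq b s) {k r : ℕ} (hr : 1 ≤ r) (hrb : r < b) :
    s (b * (b * k + r) + 1) ≤ s (b * k + 1) + s (k + 1) := by
  rw [h.mul_add_one, show b * k + r + 1 = b * k + (r + 1) by ring,
    h.mul_add k (r + 1) (by omega) (by omega)]
  rcases eq_or_lt_of_le hr with rfl | hr
  · exact le_rfl
  · rw [h.mul_add k r (by omega) hrb.le, h.mul_add_one]
    omega

/-- The inductive statement: all chords lie above the value at `b * n + 1`, and the argument can be
lowered by `b / (b + 1)` when `n` is not divisible by `b`. -/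
def ChordBound (b : ℕ) (s : ℕ → ℕ) (n : ℕ) : Prop :=
  ∀ j, 1 ≤ j → (s (b * n + 1) : ℝ) ≤ chord b j (b * n + 1) ∧
    (n % b ≠ 0 → (s (b * n + 1) : ℝ) ≤ chord b j (b * n + 1 - b / (b + 1)))

theorem chordBound_of_lt (h : IsSternSeq b s) (hb : 2 ≤ b) {n : ℕ} (hn : n < b) :
    ChordBound b s n := by
  have hb' : (2 : ℝ) ≤ b := by exact_mod_cast hb
  have hth : (0 : ℝ) ≤ b / (b + 1) := by positivity
  intro j hj
  rcases Nat.eq_zero_or_pos n with rfl | hn0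
  · refine ⟨?_, by simp⟩
    have h1 := chord_one_le hb' hj (x := 1) (by
      rw [← node_one hb']; exact node_mono hb' (by norm_num))
    have h2 := chord_node (b := b) 1
    rw [node_one hb'] at h2
    simp only [mul_zero, zero_add, h.one, Nat.cast_zero, Nat.cast_one]
    rw [h2] at h1
    simpa using h1
  · have h1 : (s (b * n + 1) : ℝ) ≤ 2 := by
      have := h.mul_add_one_le (k := 0) hn0 hn
      simp only [mul_zero, zero_add, h.one] at this
      exact_mod_cast this
    have h2 : (s (b * n + 1) : ℝ) ≤ chord b j (b * n + 1 - b / (b + 1)) := by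
      have h3 := chord_one_le hb' hj (x := node b 2) le_rfl
      rw [chord_node_succ hb'] at h3
      have h4 : node (b : ℝ) 2 ≤ b * n + 1 - b / (b + 1) := by
        rw [node_two hb']
        have : (1 : ℝ) ≤ n := by exact_mod_cast hn0
        nlinarith
      have h5 := chord_mono hb' j h4
      have h6 : (Nat.fib (1 + 2) : ℝ) = 2 := by norm_num [Nat.fib_add_two]
      linarith
    exact ⟨h2.trans (chord_mono hb' j (by linarith)), fun _ => h2⟩

/-- Beyond `node b 3 = b ^ 2 + 1` the first two chords are above the third one, so only chords of
index at least `3` matter; this is the range in which `chord_add_two` applies. -/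
theorem chord_three_le {b : ℝ} (hb : 2 ≤ b) {v x : ℝ} (hx : b ^ 2 + 1 ≤ x)
    (H : ∀ i, 1 ≤ i → v ≤ chord b (i + 2) x) {j : ℕ} (hj : 1 ≤ j) : v ≤ chord b j x := by
  rw [← node_three hb] at hx
  have h3 := H 1 le_rfl
  have h2 := h3.trans (chord_succ_le hb (j := 2) (by norm_num) hx)
  have h1 := h2.trans (chord_succ_le hb (j := 1) (by norm_num)
    ((node_mono hb (by norm_num)).trans hx))
  rcases j with _ | _ | _ | j
  · omega
  · exact h1
  · exact h2
  · exact H (j + 1) (by omega)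

/-- The inductive step for last digit `0`, where `s (b² k + 1) = s (b k + 1) + s k`. -/
theorem chordBound_mul (h : IsSternSeq b s) (hb : 2 ≤ b) {k : ℕ} (hk : 1 ≤ k)
    (IH : ∀ m < b * k, ChordBound b s m) : ChordBound b s (b * k) := by
  have hb' : (2 : ℝ) ≤ b := by exact_mod_cast hb
  have hk' : (1 : ℝ) ≤ k := by exact_mod_cast hk
  have hkb : k < b * k := by nlinarith
  have hth1 : (b : ℝ) / (b + 1) ≤ 1 := by rw [div_le_one (by positivity)]; linarith
  have G : ∀ m i, 1 ≤ m → m ≤ k → 1 ≤ i → (s m : ℝ) ≤ chord b i m := fun m i h1 h2 h3 =>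
    h.le_chord_of_residue_one hb h1 fun n hn => (IH n (by nlinarith) i h3).1
  intro j hj
  refine ⟨?_, by simp⟩
  refine chord_three_le hb' (by push_cast; nlinarith) (fun i hi => ?_) hj
  have e1 : (b : ℝ) * ((b * k : ℕ) : ℝ) + 1 = b ^ 2 * k + 1 := by push_cast; ring
  rw [e1, chord_add_two hb', h.mul_add_one, h.mul_self hb]
  push_cast
  by_cases hkm : k % b = 0
  · obtain ⟨k1, rfl⟩ := Nat.dvd_of_mod_eq_zero hkm
    have hk1 : 1 ≤ k1 := by
      rcases Nat.eq_zero_or_pos k1 with rfl | h0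
      · simp at hk
      · exact h0
    have hk1' : (1 : ℝ) ≤ k1 := by exact_mod_cast hk1
    -- The unshifted bound at `b * k + 1` loses `θ * chordSlope b (i + 1)`, which is recovered
    -- from `s k = s k1` because `k - k1 ≥ 1`.
    have h1 := (IH (b * k1) hkb (i + 1) (by omega)).1
    have h2 := G k1 i hk1 (by nlinarith) hi
    rw [h.mul_self hb]
    have h3 := chord_sub (b := b) (i + 1) (b * ((b * k1 : ℕ) : ℝ) + 1)
      (b * ((b * k1 : ℕ) : ℝ) + 1 - b / (b + 1))
    have h4 := chord_sub (b := b) i ((b * k1 : ℕ) : ℝ) k1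
    have h5 := chordSlope_succ_le hb' hi
    have h6 := chordSlope_nonneg hb' (i + 1)
    have h7 : chordSlope b (i + 1) * ((b : ℝ) / (b + 1)) ≤
        chordSlope b i * (((b * k1 : ℕ) : ℝ) - k1) := by
      have : (1 : ℝ) ≤ ((b * k1 : ℕ) : ℝ) - k1 := by push_cast; nlinarith
      calc _ ≤ chordSlope (b : ℝ) (i + 1) * 1 := by gcongr
        _ ≤ _ := mul_le_mul h5 this (by norm_num) (chordSlope_nonneg hb' _)
    have h8 : (b * ((b * k1 : ℕ) : ℝ) + 1) - (b * ((b * k1 : ℕ) : ℝ) + 1 - b / (b + 1)) =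
      (b : ℝ) / (b + 1) := by ring
    rw [h8] at h3
    linarith
  · have h1 := (IH k hkb (i + 1) (by omega)).2 hkm
    have h2 := G k i hk le_rfl hi
    linarith

/-- The inductive step for last digit `r ≠ 0`, where the value is at most
`s (b k + 1) + s (k + 1)`, with equality for `r = 1`. -/
theorem chordBound_mul_add (h : IsSternSeq b s) (hb : 2 ≤ b) {k r : ℕ} (hk : 1 ≤ k) (hr : 1 ≤ r)
    (hrb : r < b) (IH : ∀ m < b * k + r, ChordBound b s m) : ChordBound b s (b * k + r) := by
  have hb' : (2 : ℝ) ≤ b := by exact_mod_cast hb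
  have hk' : (1 : ℝ) ≤ k := by exact_mod_cast hk
  have hr' : (1 : ℝ) ≤ r := by exact_mod_cast hr
  have hkb : k < b * k + r := by nlinarith
  have hth0 : (0 : ℝ) ≤ b / (b + 1) := by positivity
  have hth1 : (b : ℝ) / (b + 1) ≤ 1 := by rw [div_le_one (by positivity)]; linarith
  have G : ∀ m i, 1 ≤ m → m ≤ k → 1 ≤ i → (s m : ℝ) ≤ chord b i m := fun m i h1 h2 h3 =>
    h.le_chord_of_residue_one hb h1 fun n hn => (IH n (by nlinarith) i h3).1
  -- The bound holds already at the position belonging to the least possible digit `r = 1`.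
  have key : ∀ j, 1 ≤ j → (s (b * (b * k + r) + 1) : ℝ) ≤
      chord b j (b ^ 2 * (k + 1 - b / (b + 1)) + 1) := by
    intro j hj
    have hθ : (b : ℝ) ^ 2 * (k + 1 - b / (b + 1)) = b ^ 2 * k + b ^ 2 / (b + 1) := by
      field_simp; ring
    have hθ' : (0 : ℝ) ≤ b ^ 2 / (b + 1) := by positivity
    refine chord_three_le hb' (by rw [hθ]; nlinarith) (fun i hi => ?_) hj
    have h0 : (s (b * (b * k + r) + 1) : ℝ) ≤ s (b * k + 1) + s (k + 1) := by
      exact_mod_cast h.mul_add_one_le hr hrb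
    have e1 : (b : ℝ) * (k + 1 - b / (b + 1)) + 1 - b / (b + 1) = b * k + 1 := by
      field_simp; ring
    have h1 := (IH k hkb (i + 1) (by omega)).1
    by_cases hkm : k % b = 0
    · obtain ⟨k1, rfl⟩ := Nat.dvd_of_mod_eq_zero hkm
      have hk1 : 1 ≤ k1 := by
        rcases Nat.eq_zero_or_pos k1 with rfl | h0
        · simp at hk
        · exact h0
      have hk1' : k1 < b * (b * k1) + r := by nlinarith
      by_cases hkm1 : k1 % b = 0
      · -- Here `k + 1 = b * k1 + 1` has no shifted bound. Unfolding once more gives the total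
        -- `2 * s (b * k1 + 1) + s k2`, with `s k2` far below the chord at `k1 = b * k2`.
        obtain ⟨k2, rfl⟩ := Nat.dvd_of_mod_eq_zero hkm1
        have hk2 : 1 ≤ k2 := by
          rcases Nat.eq_zero_or_pos k2 with rfl | h0
          · simp at hk
          · exact h0
        have hk2' : (1 : ℝ) ≤ k2 := by exact_mod_cast hk2
        have h0 : (s (b * (b * (b * (b * k2)) + r) + 1) : ℝ) ≤
            2 * s (b * (b * k2) + 1) + s k2 := by
          have : s (b * (b * (b * k2)) + 1) = s k2 + s (b * (b * k2) + 1) := by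
            rw [h.mul_add_one, h.mul_self hb, h.mul_self hb]
          rw [this] at h0
          push_cast at h0
          linarith
        -- Applying `chord_add_two` twice needs an index at least `4`.
        have hi2 : ∀ l, 1 ≤ l → (s (b * (b * (b * (b * k2)) + r) + 1) : ℝ) ≤
            chord b (l + 3) (b ^ 2 * (((b * (b * k2) : ℕ) : ℝ) + 1 - b / (b + 1)) + 1) := by
          intro l hl
          have g1 := (IH (b * k2) hk1' (l + 1) (by omega)).1
          rw [show l + 3 = (l + 1) + 2 by ring, chord_add_two hb', e1]
          have e2 : (b : ℝ) * ((b * (b * k2) : ℕ) : ℝ) + 1 = b ^ 2 * (b * k2 : ℕ) + 1 := by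
            push_cast; ring
          have e3 : ((b * (b * k2) : ℕ) : ℝ) = b * (b * k2 : ℕ) := by push_cast; ring
          rw [e2, chord_add_two hb', e3]
          have g2 := chord_sub (b := b) (l + 1) (b * ((b * k2 : ℕ) : ℝ) + 1)
            (b * ((b * k2 : ℕ) : ℝ) + 1 - b / (b + 1))
          have e4 : (b * ((b * k2 : ℕ) : ℝ) + 1) - (b * ((b * k2 : ℕ) : ℝ) + 1 - b / (b + 1)) =
            (b : ℝ) / (b + 1) := by ring
          rw [e4] at g2
          -- The gap at `k1` pays for two shifts; for `k2 = 1` it is computed from the first chord.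
          have g3 : s k2 + 2 * (chordSlope b (l + 1) * ((b : ℝ) / (b + 1))) ≤
              chord b l ((b * k2 : ℕ) : ℝ) := by
            rcases eq_or_lt_of_le hk2 with rfl | hk3
            · have f1 : chordSlope (b : ℝ) (l + 1) ≤ chordSlope b 2 :=
                chordSlope_anti hb' (by norm_num) (by omega)
              have f2 : (b : ℝ) ≤ node b 2 := by rw [node_two hb']; linarith
              have f3 := chord_one_le hb' hl f2
              have f4 : chord (b : ℝ) 1 b = 1 + (b + 1) / b ^ 2 * (b - 1) := by
                unfold chord
                rw [node_one hb']
                norm_num [chordSlope]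
              have f5 : chordSlope (b : ℝ) 2 * (b / (b + 1)) = 1 / b ^ 2 := by
                norm_num [chordSlope]
                field_simp
              have f6 := mul_le_mul_of_nonneg_right f1 hth0
              have f7 : 2 * (1 / (b : ℝ) ^ 2) ≤ (b + 1) / b ^ 2 * (b - 1) := by
                rw [mul_one_div, div_mul_eq_mul_div]
                gcongr
                nlinarith
              rw [h.one, mul_one, Nat.cast_one]
              linarith
            · have f1 := G k2 l hk2 (by nlinarith) hl
              have f2 := chord_sub (b := b) l ((b * k2 : ℕ) : ℝ) k2
              have f3 : (2 : ℝ) ≤ ((b * k2 : ℕ) : ℝ) - k2 := by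
                have : (2 : ℝ) ≤ k2 := by exact_mod_cast hk3
                push_cast; nlinarith
              have f4 : chordSlope b (l + 1) * ((b : ℝ) / (b + 1)) ≤ chordSlope b l * 1 :=
                mul_le_mul (chordSlope_succ_le hb' hl) hth1 hth0 (chordSlope_nonneg hb' _)
              have f5 := mul_le_mul_of_nonneg_left f3 (chordSlope_nonneg hb' l)
              linarith
          linarith
        -- Chord `3` is above chord `4` beyond `node b 4`.
        rcases eq_or_lt_of_le hi with rfl | hi
        · refine (hi2 1 le_rfl).trans (chord_succ_le hb' (by norm_num)
            ((node_four_le hb').trans ?_))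
          rw [hθ]
          push_cast
          have : (0 : ℝ) ≤ b ^ 4 * (k2 - 1) := by
            have : (0 : ℝ) ≤ k2 - 1 := by linarith
            positivity
          nlinarith
        · obtain ⟨l, rfl⟩ : ∃ l, i = l + 1 := ⟨i - 1, by omega⟩
          exact hi2 l (by omega)
      · rw [chord_add_two hb', e1]
        have h2 := (IH k1 hk1' i hi).2 hkm1
        have e3 : ((b * k1 : ℕ) : ℝ) = b * k1 := by push_cast; ring
        rw [e3] at h1 ⊢
        linarith
    · -- A nonzero last digit of `k` gives `s (k + 1) ≤ s (b * k1 + 1)` with `b * k1 + 1 ≤ k`,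
      -- to the left of the shifted argument.
      rw [chord_add_two hb', e1]
      have hd := Nat.div_add_mod k b
      have hlt := Nat.mod_lt k (show 0 < b by omega)
      set k1 := k / b
      have h2 : s (k + 1) ≤ s (b * k1 + 1) := by
        rw [show k + 1 = b * k1 + (k % b + 1) by omega, h.mul_add k1 _ (by omega) (by omega),
          h.mul_add_one]
        omega
      have h2' : (s (k + 1) : ℝ) ≤ s (b * k1 + 1) := by exact_mod_cast h2
      have h3 := G (b * k1 + 1) i (by omega) (by omega) hi
      have h4 : chord (b : ℝ) i ((b * k1 + 1 : ℕ) : ℝ) ≤ chord b i (k + 1 - b / (b + 1)) := by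
        apply chord_mono hb'
        have : ((b * k1 + 1 : ℕ) : ℝ) ≤ k := by exact_mod_cast (show b * k1 + 1 ≤ k by omega)
        linarith
      linarith
  have hpos : (b : ℝ) ^ 2 * (k + 1 - b / (b + 1)) + 1 ≤
      b * ((b * k + r : ℕ) : ℝ) + 1 - b / (b + 1) := by
    have : (b : ℝ) ^ 2 * (k + 1 - b / (b + 1)) = b ^ 2 * k + b - b / (b + 1) := by
      field_simp; ring
    rw [this]
    push_cast
    nlinarith
  intro j hj
  have h1 := (key j hj).trans (chord_mono hb' j hpos)
  exact ⟨h1.trans (chord_mono hb' j (by linarith)), fun _ => h1⟩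

theorem chordBound (h : IsSternSeq b s) (hb : 2 ≤ b) (n : ℕ) : ChordBound b s n := by
  induction n using Nat.strong_induction_on with
  | _ n IH =>
    rcases lt_or_ge n b with hn | hn
    · exact h.chordBound_of_lt hb hn
    · have hd := Nat.div_add_mod n b
      have hlt := Nat.mod_lt n (show 0 < b by omega)
      have hk : 1 ≤ n / b := (Nat.one_le_div_iff (by omega)).mpr hn
      rcases Nat.eq_zero_or_pos (n % b) with h0 | h0
      · rw [h0, add_zero] at hd
        rw [← hd] at IH ⊢
        exact h.chordBound_mul hb hk IH
      · rw [← hd] at IH ⊢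
        exact h.chordBound_mul_add hb hk h0 hlt IH

/-- A Stern sequence lies below the concave polygon through the points `(node b j, fib (j + 1))`. -/
theorem le_chord (h : IsSternSeq b s) (hb : 2 ≤ b) {j n : ℕ} (hj : 1 ≤ j) (hn : 1 ≤ n) :
    (s n : ℝ) ≤ chord b j n :=
  h.le_chord_of_residue_one hb hn fun m _ => (h.chordBound hb m j hj).1

end IsSternSeq

/-! ### Asymptotics -/

theorem coe_fib_le (k : ℕ) : (Nat.fib k : ℝ) ≤ Real.goldenRatio ^ k / √5 + 1 := by
  have h5 : (1 : ℝ) ≤ √5 := Real.one_le_sqrt.mpr (by norm_num)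
  have h1 : |Real.goldenConj ^ k| ≤ 1 := by
    rw [abs_pow]
    apply pow_le_one₀ (abs_nonneg _)
    rw [abs_le]
    exact ⟨Real.neg_one_lt_goldenConj.le, Real.goldenConj_neg.le.trans zero_le_one⟩
  have h2 : -(Real.goldenConj ^ k / √5) ≤ 1 := by
    rw [← neg_div, div_le_one (by linarith)]
    linarith [neg_abs_le (Real.goldenConj ^ k)]
  rw [Real.coe_fib_eq, sub_div]
  linarith

theorem fib_le_two_pow (k : ℕ) : Nat.fib k ≤ 2 ^ k := by
  induction k using Nat.twoStepInduction with
  | zero => simp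
  | one => simp
  | more k h1 h2 =>
    rw [Nat.fib_add_two]
    rw [pow_succ] at h2 ⊢
    omega

theorem tendsto_fib_div_goldenRatio_pow :
    Tendsto (fun k => (Nat.fib k : ℝ) / Real.goldenRatio ^ k) atTop (nhds (1 / √5)) := by
  have hφ := Real.goldenRatio_pos
  have h1 : Tendsto (fun k : ℕ => (Real.goldenConj / Real.goldenRatio) ^ k) atTop (nhds 0) := by
    apply tendsto_pow_atTop_nhds_zero_of_abs_lt_one
    rw [abs_div, abs_of_pos hφ, div_lt_one hφ, abs_lt]
    constructor
    · linarith [Real.neg_one_lt_goldenConj, Real.one_lt_goldenRatio]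
    · linarith [Real.goldenConj_neg]
  have h2 := (h1.const_sub 1).div_const √5
  rw [sub_zero] at h2
  refine h2.congr fun k => ?_
  rw [Real.coe_fib_eq, div_pow]
  have : Real.goldenRatio ^ k ≠ 0 := by positivity
  field_simp

section exponent

variable {b : ℝ}

theorem logb_goldenRatio_pos (hb : 2 ≤ b) : 0 < Real.logb b Real.goldenRatio :=
  Real.logb_pos (by linarith) Real.one_lt_goldenRatio

theorem logb_goldenRatio_le_one (hb : 2 ≤ b) : Real.logb b Real.goldenRatio ≤ 1 := by
  rw [Real.logb_le_iff_le_rpow (by linarith) Real.goldenRatio_pos, Real.rpow_one]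
  linarith [Real.goldenRatio_lt_two]

theorem pow_rpow_logb_goldenRatio (hb : 2 ≤ b) (m : ℕ) :
    (b ^ m) ^ Real.logb b Real.goldenRatio = Real.goldenRatio ^ m := by
  rw [← Real.rpow_natCast, ← Real.rpow_mul (by linarith), mul_comm, Real.rpow_mul (by linarith),
    Real.rpow_logb (by linarith) (by linarith) Real.goldenRatio_pos, Real.rpow_natCast]

/-- On `[1, b]` the concave function `u ^ log_b φ` lies above its chord. -/
theorem chord_le_rpow_logb_goldenRatio (hb : 2 ≤ b) {u : ℝ} (h1 : 1 ≤ u) (h2 : u ≤ b) :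
    1 + (Real.goldenRatio - 1) * ((u - 1) / (b - 1)) ≤ u ^ Real.logb b Real.goldenRatio := by
  have hb1 : 0 < b - 1 := by linarith
  have hconc := Real.concaveOn_rpow (logb_goldenRatio_pos hb).le (logb_goldenRatio_le_one hb)
  have hc := hconc.2 (Set.mem_Ici.mpr zero_le_one) (Set.mem_Ici.mpr (by linarith : 0 ≤ b))
    (div_nonneg (by linarith) hb1.le : 0 ≤ (b - u) / (b - 1))
    (div_nonneg (by linarith) hb1.le : 0 ≤ (u - 1) / (b - 1))
    (by field_simp; ring)
  have e1 : ((b - u) / (b - 1)) • (1 : ℝ) + ((u - 1) / (b - 1)) • b = u := by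
    simp only [smul_eq_mul]; field_simp; ring
  rw [e1] at hc
  beta_reduce at hc
  rw [Real.one_rpow, Real.rpow_logb (by linarith) (by linarith) Real.goldenRatio_pos] at hc
  simp only [smul_eq_mul] at hc
  refine le_trans (le_of_eq ?_) hc
  field_simp
  ring

end exponent

/-- The integer with base `b` digits `1, 0, 1, …, 0, 1`, with `i + 1` ones. -/
def peak (b : ℕ) : ℕ → ℕ
  | 0 => 1
  | i + 1 => b ^ 2 * peak b i + 1

theorem peak_mul (b i : ℕ) : (peak b i : ℝ) * ((b : ℝ) ^ 2 - 1) = ((b : ℝ) ^ (2 * i + 2) - 1) := by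
  induction i with
  | zero => simp [peak]
  | succ i ih =>
    simp only [peak]
    push_cast
    rw [show 2 * (i + 1) + 2 = (2 * i + 2) + 2 by ring, pow_add]
    linear_combination (b : ℝ) ^ 2 * ih

theorem lt_peak {b : ℕ} (hb : 2 ≤ b) (i : ℕ) : i < peak b i := by
  induction i with
  | zero => simp [peak]
  | succ i ih =>
    have : peak b i ≤ b ^ 2 * peak b i := Nat.le_mul_of_pos_left _ (by positivity)
    simp only [peak]
    omega

namespace IsSternSeq

variable {b : ℕ} {s : ℕ → ℕ}

/-- The explicit upper bound. The index `j` is chosen with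
`b ^ (j + 1) ≤ (b ^ 2 - 1) * n < b ^ (j + 2)`. -/
theorem le_rpow (h : IsSternSeq b s) (hb : 2 ≤ b) {n : ℕ} (hn : 2 ≤ n) :
    (s n : ℝ) ≤ (((b : ℝ) ^ 2 - 1) * n) ^ Real.logb b Real.goldenRatio / √5 + 3 := by
  have hb' : (2 : ℝ) ≤ b := by exact_mod_cast hb
  have hn' : (2 : ℝ) ≤ n := by exact_mod_cast hn
  have hb1 : 0 < (b : ℝ) - 1 := by linarith
  have hbb : 0 < (b : ℝ) ^ 2 - 1 := by nlinarith
  have h5 : (0 : ℝ) < √5 := by positivity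
  set y : ℝ := ((b : ℝ) ^ 2 - 1) * n with hy
  have hy2 : (b : ℝ) ^ 2 ≤ y := by nlinarith
  obtain ⟨m, hm1, hm2⟩ := exists_nat_pow_near (x := y) (y := b) (by nlinarith) (by linarith)
  have hm : 2 ≤ m := by
    have := (pow_lt_pow_iff_right₀ (show (1 : ℝ) < b by linarith)).mp (hy2.trans_lt hm2)
    omega
  obtain ⟨j, rfl⟩ : ∃ j, m = j + 1 := ⟨m - 1, by omega⟩
  have hp : 0 < (b : ℝ) ^ (j + 1) := by positivity
  obtain ⟨u, hu⟩ : ∃ u, u = y / b ^ (j + 1) := ⟨_, rfl⟩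
  have hyu : y = b ^ (j + 1) * u := by rw [hu]; field_simp
  have hu1 : 1 ≤ u := by rw [hu, le_div_iff₀ hp]; linarith
  have hu2 : u ≤ b := by rw [hu, div_le_iff₀ hp]; rw [pow_succ] at hm2; linarith
  have hv0 : 0 ≤ (u - 1) / ((b : ℝ) - 1) := div_nonneg (by linarith) hb1.le
  have hv1 : (u - 1) / ((b : ℝ) - 1) ≤ 1 := by rw [div_le_one hb1]; linarith
  have hc : chord (b : ℝ) j n =
      Nat.fib (j + 1) + Nat.fib j * ((u - 1) / (b - 1)) + Nat.fib j / b ^ (j + 1) / (b - 1) := by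
    have e : (n : ℝ) = b ^ (j + 1) * u / (b ^ 2 - 1) := by
      rw [← hyu, hy]; field_simp
    unfold chord chordSlope node
    rw [e]
    have : (b : ℝ) + 1 ≠ 0 := by linarith
    have e2 : (b : ℝ) ^ 2 - 1 = (b - 1) * (b + 1) := by ring
    rw [e2]
    field_simp
    ring
  have hsmall : (Nat.fib j : ℝ) / b ^ (j + 1) / (b - 1) ≤ 1 := by
    rw [div_div, div_le_one (by positivity)]
    have g1 : (Nat.fib j : ℝ) ≤ 2 ^ j := by exact_mod_cast fib_le_two_pow j
    have g2 : (2 : ℝ) ^ j ≤ b ^ j := pow_le_pow_left₀ (by norm_num) hb' j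
    have g3 : (b : ℝ) ^ j ≤ b ^ (j + 1) := pow_le_pow_right₀ (by linarith) (by omega)
    have g4 : (b : ℝ) ^ (j + 1) * 1 ≤ b ^ (j + 1) * (b - 1) := by gcongr; linarith
    linarith
  have h1 := h.le_chord hb (j := j) (by omega) (show 1 ≤ n by omega)
  rw [hc] at h1
  have f1 := coe_fib_le (j + 1)
  have f2 := mul_le_mul_of_nonneg_right (coe_fib_le j) hv0
  -- `φ⁻¹ = φ - 1` turns the increment of the Fibonacci chord into that of `u ^ log_b φ`.
  have hg : Real.goldenRatio ^ j = Real.goldenRatio ^ (j + 1) * (Real.goldenRatio - 1) := by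
    have := Real.goldenRatio_sq
    linear_combination (-Real.goldenRatio ^ j) * this
  have h2 := chord_le_rpow_logb_goldenRatio hb' hu1 hu2
  have h3 := mul_le_mul_of_nonneg_left h2
    (show 0 ≤ Real.goldenRatio ^ (j + 1) / √5 by
      have := Real.goldenRatio_pos
      positivity)
  have h4 : y ^ Real.logb b Real.goldenRatio =
      Real.goldenRatio ^ (j + 1) * u ^ Real.logb b Real.goldenRatio := by
    rw [hyu, Real.mul_rpow hp.le (by linarith), pow_rpow_logb_goldenRatio hb']
  rw [h4]
  rw [hg] at f2
  have h6 : Real.goldenRatio ^ (j + 1) / √5 *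
      (1 + (Real.goldenRatio - 1) * ((u - 1) / ((b : ℝ) - 1))) =
      Real.goldenRatio ^ (j + 1) / √5 + Real.goldenRatio ^ (j + 1) * (Real.goldenRatio - 1) / √5 *
        ((u - 1) / ((b : ℝ) - 1)) := by ring
  rw [h6] at h3
  have h7 : Real.goldenRatio ^ (j + 1) / √5 * u ^ Real.logb b Real.goldenRatio =
    Real.goldenRatio ^ (j + 1) * u ^ Real.logb b Real.goldenRatio / √5 := by ring
  rw [h7] at h3
  rw [add_mul] at f2
  linarith

theorem apply_peak (h : IsSternSeq b s) (hb : 2 ≤ b) (i : ℕ) :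
    s (peak b i) = Nat.fib (2 * i + 2) ∧ s (peak b i + 1) = Nat.fib (2 * i + 1) := by
  induction i with
  | zero =>
    have := h.mul_add 0 2 le_rfl hb
    simp only [mul_zero, zero_add] at this
    simp [peak, h.one, this]
  | succ i ih =>
    have e : b ^ 2 * peak b i = b * (b * peak b i) := by ring
    have f1 : Nat.fib (2 * (i + 1) + 1) = Nat.fib (2 * i + 1) + Nat.fib (2 * i + 2) :=
      Nat.fib_add_two
    have f2 : Nat.fib (2 * (i + 1) + 2) = Nat.fib (2 * i + 2) + Nat.fib (2 * (i + 1) + 1) :=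
      Nat.fib_add_two
    simp only [peak]
    rw [e, h.mul_add_one, add_assoc, h.mul_add _ 2 le_rfl hb, h.mul_add_one, h.mul_self hb, ih.1,
      ih.2]
    omega

/-- The maximal order of any base `b` Stern sequence. -/
theorem limsup_eq (h : IsSternSeq b s) (hb : 2 ≤ b) :
    limsup (fun n : ℕ =>
        (((s n : ℝ) / (n : ℝ) ^ Real.logb b Real.goldenRatio : ℝ) : EReal)) atTop
      = ((((b : ℝ) ^ 2 - 1) ^ Real.logb b Real.goldenRatio / √5 : ℝ) : EReal) := by
  have hb' : (2 : ℝ) ≤ b := by exact_mod_cast hb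
  have hbb : 0 < (b : ℝ) ^ 2 - 1 := by nlinarith
  have hα := logb_goldenRatio_pos hb'
  set α := Real.logb b Real.goldenRatio with hαdef
  apply le_antisymm
  · have hlim : Tendsto (fun n : ℕ => ((b : ℝ) ^ 2 - 1) ^ α / √5 + 3 / (n : ℝ) ^ α) atTop
        (nhds (((b : ℝ) ^ 2 - 1) ^ α / √5)) := by
      have h1 : Tendsto (fun n : ℕ => 3 / (n : ℝ) ^ α) atTop (nhds 0) :=
        ((tendsto_rpow_atTop hα).comp tendsto_natCast_atTop_atTop).const_div_atTop 3
      simpa using h1.const_add (((b : ℝ) ^ 2 - 1) ^ α / √5)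
    have hlim' := (continuous_coe_real_ereal.tendsto _).comp hlim
    rw [← hlim'.limsup_eq]
    refine limsup_le_limsup ?_
    filter_upwards [eventually_ge_atTop 2] with n hn
    simp only [Function.comp_apply, EReal.coe_le_coe_iff]
    have hn' : (0 : ℝ) < n := by
      have : 0 < n := by omega
      exact_mod_cast this
    have hp := Real.rpow_pos_of_pos hn' α
    rw [div_le_iff₀ hp]
    have h1 := h.le_rpow hb hn
    rw [← hαdef, Real.mul_rpow hbb.le hn'.le] at h1
    refine h1.trans (le_of_eq ?_)
    field_simp
  · have hpk : Tendsto (peak b) atTop atTop :=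
      tendsto_atTop_mono (fun i => (lt_peak hb i).le) tendsto_id
    have hlim : Tendsto (fun i : ℕ => ((b : ℝ) ^ 2 - 1) ^ α *
        ((Nat.fib (2 * i + 2) : ℝ) / Real.goldenRatio ^ (2 * i + 2))) atTop
        (nhds (((b : ℝ) ^ 2 - 1) ^ α / √5)) := by
      have h1 : Tendsto (fun i : ℕ => 2 * i + 2) atTop atTop :=
        tendsto_atTop_mono (fun i => by simp only [id]; omega) tendsto_id
      have h2 := (tendsto_fib_div_goldenRatio_pow.comp h1).const_mul (((b : ℝ) ^ 2 - 1) ^ α)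
      rw [mul_one_div] at h2
      exact h2
    have hlim' := (continuous_coe_real_ereal.tendsto _).comp hlim
    rw [← hlim'.limsup_eq]
    refine le_trans ?_ (limsup_le_limsup_of_le hpk)
    rw [← limsup_comp]
    refine limsup_le_limsup (Eventually.of_forall fun i => ?_)
    simp only [Function.comp_apply, EReal.coe_le_coe_iff]
    have hn' : (0 : ℝ) < peak b i := by
      have := lt_peak hb i
      exact_mod_cast (by omega : 0 < peak b i)
    have hp := Real.rpow_pos_of_pos hn' α
    rw [le_div_iff₀ hp, (h.apply_peak hb i).1]
    have h1 : ((b : ℝ) ^ 2 - 1) ^ α * (peak b i : ℝ) ^ α ≤ Real.goldenRatio ^ (2 * i + 2) := by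
      rw [← Real.mul_rpow hbb.le hn'.le, ← pow_rpow_logb_goldenRatio hb', ← hαdef]
      apply Real.rpow_le_rpow (by positivity) _ hα.le
      rw [mul_comm, peak_mul]
      linarith
    have hφ := Real.goldenRatio_pos
    have h2 : 0 ≤ (Nat.fib (2 * i + 2) : ℝ) / Real.goldenRatio ^ (2 * i + 2) := by positivity
    calc _ = (Nat.fib (2 * i + 2) : ℝ) / Real.goldenRatio ^ (2 * i + 2) *
          (((b : ℝ) ^ 2 - 1) ^ α * (peak b i : ℝ) ^ α) := by ring
      _ ≤ (Nat.fib (2 * i + 2) : ℝ) / Real.goldenRatio ^ (2 * i + 2) *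
          Real.goldenRatio ^ (2 * i + 2) := by gcongr
      _ = _ := by field_simp

end IsSternSeq

theorem mainTheorem1 :
    (∀ b : ℕ, 2 ≤ b →
      limsup (fun n : ℕ =>
          (((sternB b n : ℝ) / (n : ℝ) ^ Real.logb b Real.goldenRatio : ℝ) : EReal)) atTop
        = ((((b : ℝ) ^ 2 - 1) ^ Real.logb b Real.goldenRatio / √5 : ℝ) : EReal)) ∧
    limsup (fun n : ℕ =>
        (((stern n : ℝ) / (n : ℝ) ^ Real.logb 2 Real.goldenRatio : ℝ) : EReal)) atTop
      = (((3 : ℝ) ^ Real.logb 2 Real.goldenRatio / √5 : ℝ) : EReal) := by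
  refine ⟨fun b hb => (isSternSeq_sternB hb).limsup_eq hb, ?_⟩
  have h := isSternSeq_stern.limsup_eq le_rfl
  norm_num at h ⊢
  exact h
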